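/- **Theorem (Wall-particle correlation function).** Let $(p_{s,t}(x,y))_{0\le s\le t}$ be a (possibly time-inhomogeneous) stochastic transition function on $\mathbb{Z}$ with $\lim_{t\downarrow s}p_{s,t}(x,x)=1$ for all $s,x$ (discrete-time chains are included as processes that move only at integer times). Let $(\xi^x)_{x\in\mathbb{Z}}$ be independent Markov processes with right-continuous paths, with transition function $p$ and with $\xi^x_0=x$. Assume that the process is *skip-free*: for $x<y$, almost surely, $\xi^x_t<\xi^y_t$ for every $t$ such that $\xi^x_u\ne\xi^y_u$ for all $u\le t$ (two independent particles cannot exchange order without being at the same site at the same time). Consider the coalescing system with every site of $\mathbb{Z}$ initially occupied, given by Arratia's construction: the sites are enumerated in an arbitrary order of priority, and the particle started at $x$ follows $\xi^x$ until it first meets a particle of higher priority, with which it moves together from then on. Let $X^x_T$ be the position at time $T>0$ of the particle started at $x$. A *survivor* is a position $y$ with $y=X^x_T$ for some $x$; its *basin* is $\{x\in\mathbb{Z}: X^x_T=y\}$ (almost surely a set of consecutive integers); a *wall* is the half-integer that separates two neighbouring basins. Let $k\ge 1$, let $x_{1/2}<x_{3/2}<\dots<x_{k-1/2}$ be elements of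 $\mathbb{Z}+\tfrac12$ and let $y_0<\dots<y_k$ be integers. The walls and survivors *contain the consecutive pattern* $$y_0\nwarrow x_{1/2}\nearrow y_1\nwarrow x_{3/2}\nearrow\cdots\nwarrow x_{k-1/2}\nearrow y_k$$ if $y_0,\dots,y_k$ are survivors and, for each $l=1,\dots,k$, $x_{l-1/2}$ is both the right end of the basin of $y_{l-1}$ (i.e. $x_{l-1/2}-\tfrac12$ is its largest element) and the left end of the basin of $y_l$ (i.e. $x_{l-1/2}+\tfrac12$ is its smallest element). Then this is a measurable event and its probability equals $\det(\tilde M)$. Here $\tilde M$ is the coalescence matrix for the $2k$ particles started at $a_1,b_1,\dots,a_k,b_k$, where $a_l=x_{l-1/2}-\tfrac12$ and $b_l=x_{l-1/2}+\tfrac12$, with coalescence pattern $1+2+\cdots+2+1$: $a_1$ survives alone at $y_0$, each pair $(b_l,a_{l+1})$ merges into the survivor $y_l$ ($1\le l\le k-1$), and $b_k$ survives alone at $y_k$. Explicitly, let $P(x,y)=p_{0,T}(x,y)$ and $F(x,y)=\sum_{z\le y}P(x,z)$, let $c_1,\dots,c_{2k}$ be the starting positions in the above order, and let $y_{\beta(j)}$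 be the survivor of particle $j$. If $j$ is the first particle in its group, then $\tilde M_{ij}=P(c_i,y_{\beta(j)})$ for all $i$; otherwise $\tilde M_{ij}=F(c_i,y_{\beta(j)})-[i<j]$, where $[\cdot]$ is the Iverson bracket. -/

import Mathlib

open MeasureTheory ProbabilityTheory Filter Topology
open scoped NNReal

/-- A (possibly time-inhomogeneous) standard stochastic transition function on `ℤ`:
`p s t x y` is the probability to be at `y` at time `t` when at `x` at time `s ≤ t`.
Time is `[0, ∞)`. A discrete-time chain is the special case where nothing moves except at the
times `1, 2, 3, …`, i.e. `p s t` depends only on `⌊s⌋` and `⌊t⌋`. -/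
structure IsTransitionFunction (p : ℝ≥0 → ℝ≥0 → ℤ → ℤ → ℝ) : Prop where
  nonneg : ∀ s t x y, s ≤ t → 0 ≤ p s t x y
  hasSum_one : ∀ s t x, s ≤ t → HasSum (p s t x) 1
  refl : ∀ s x y, p s s x y = if x = y then 1 else 0
  chapman_kolmogorov : ∀ s u t x y, s ≤ u → u ≤ t →
    HasSum (fun z => p s u x z * p u t z y) (p s t x y)
  standard : ∀ s x, Tendsto (fun t => p s t x x) (𝓝[≥] s) (𝓝 1)

/-- `ξ` is a Markov process on `ℤ` with transition function `p`, started at `x` at time `0`,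
with right-continuous paths. -/
structure IsMarkovProcessFrom {Ω : Type*} [MeasurableSpace Ω] (μ : Measure Ω)
    (p : ℝ≥0 → ℝ≥0 → ℤ → ℤ → ℝ) (x : ℤ) (ξ : ℝ≥0 → Ω → ℤ) : Prop where
  measurable : ∀ t, Measurable (ξ t)
  start : ∀ ω, ξ 0 ω = x
  right_continuous : ∀ ω t, ContinuousWithinAt (fun s => ξ s ω) (Set.Ici t) t
  /-- the finite-dimensional distributions -/
  fdd : ∀ (n : ℕ) (t : Fin (n + 1) → ℝ≥0) (z : Fin (n + 1) → ℤ),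
    Monotone t → t 0 = 0 → z 0 = x →
    μ.real {ω | ∀ i, ξ (t i) ω = z i} =
      ∏ i : Fin n, p (t i.castSucc) (t i.succ) (z i.castSucc) (z i.succ)

/-- Skip-freeness of a process, in terms of independent copies `ξ x` of it started at the
sites `x`: two particles cannot exchange their order without meeting, i.e. without being at
the same site at the same time. -/
def IsSkipFree {Ω : Type*} [MeasurableSpace Ω] (μ : Measure Ω)
    (ξ : ℤ → ℝ≥0 → Ω → ℤ) : Prop :=
  ∀ x y : ℤ, x < y → ∀ᵐ ω ∂μ, ∀ t : ℝ≥0,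
    (∀ u ≤ t, ξ x u ω ≠ ξ y u ω) → ξ x t ω < ξ y t ω

open Classical in
/-- Arratia's construction, pathwise, for particles labelled by priority `0, 1, 2, …` with
prescribed trajectories `η 0, η 1, η 2, …`. Particle `n` follows `η n` until the first time `u`
at which it is at the same site as one of the particles `m < n` (already constructed); from
then on it moves together with that particle. -/
noncomputable def arratia (η : ℕ → ℝ≥0 → ℤ) (n : ℕ) (t : ℝ≥0) : ℤ :=
  if h : ∃ m : Fin n, ∃ u ≤ t, η n u = arratia η m u ∧
      ∀ v < u, ∀ m' : Fin n, η n v ≠ arratia η m' v then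
    arratia η h.choose t
  else η n t
termination_by n
decreasing_by all_goals exact Fin.isLt _

/-- The coalescing system on `ℤ` with every site initially occupied, built from the
trajectories `ξ x`, `x ∈ ℤ`: `coalescingSystem rank ξ x t` is the position at time `t` of the
particle that starts at `x`. The enumeration `rank` of the sites gives the priorities. -/
noncomputable def coalescingSystem (rank : ℤ ≃ ℕ) (ξ : ℤ → ℝ≥0 → ℤ) (x : ℤ) (t : ℝ≥0) : ℤ :=
  arratia (fun n => ξ (rank.symm n)) (rank x) t

/-- For `f x` the final position of the particle started at `x`: the basin of the survivor
at `y`. It is non-empty exactly when there is a survivor at `y`. -/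
def basin (f : ℤ → ℤ) (y : ℤ) : Set ℤ := {x | f x = y}

/-- `y ↖ x` for the half-integer `x = a + 1/2`: there is a survivor at `y`, and the
wall bounding its basin on the right is at `a + 1/2`. -/
def WallRightOf (f : ℤ → ℤ) (y a : ℤ) : Prop := IsGreatest (basin f y) a

/-- `x ↗ y` for the half-integer `x = a + 1/2`: there is a survivor at `y`, and the
wall bounding its basin on the left is at `a + 1/2`. -/
def WallLeftOf (f : ℤ → ℤ) (a y : ℤ) : Prop := IsLeast (basin f y) (a + 1)

/-- The walls and survivors contain the consecutive pattern
`y 0 ↖ x 0 ↗ y 1 ↖ x 1 ↗ ⋯ ↖ x (k - 1) ↗ y k`, where `x l = a l + 1/2`. -/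
def ContainsPattern (f : ℤ → ℤ) {k : ℕ} (a : Fin k → ℤ) (y : Fin (k + 1) → ℤ) : Prop :=
  ∀ l : Fin k, WallRightOf f (y l.castSucc) (a l) ∧ WallLeftOf f (a l) (y l.succ)

/-- The cumulative sum `F(x, y) = ∑_{z ≤ y} P(x, z)`. -/
noncomputable def cumulative (P : ℤ → ℤ → ℝ) (x y : ℤ) : ℝ := ∑' z : Set.Iic y, P x z

open Classical in
/-- The coalescence matrix for `n` particles started at `x 0, …, x (n - 1)`, where particle `i`
ends in the survivor number `b i`, located at `y (b i)`. The pattern is encoded by the weakly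
increasing map `b`. The first column of each block is a `P` column; every other column `j` of
the block is an `F` column with the staircase `[i < j]` subtracted. -/
noncomputable def coalescenceMatrix (P : ℤ → ℤ → ℝ) {n m : ℕ} (x : Fin n → ℤ)
    (b : Fin n → Fin m) (y : Fin m → ℤ) : Matrix (Fin n) (Fin n) ℝ :=
  Matrix.of fun i j =>
    if ∃ j' < j, b j' = b j then
      cumulative P (x i) (y (b j)) - (if i < j then 1 else 0)
    else P (x i) (y (b j))

/-- The flanking particles `a₁, b₁, …, a_k, b_k`, where `b_l = a_l + 1`. -/
def flanking {k : ℕ} (a : Fin k → ℤ) (i : Fin (2 * k)) : ℤ :=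
  a ⟨(i : ℕ) / 2, by have := i.isLt; omega⟩ + ((i : ℕ) % 2 : ℕ)

/-- The pattern `1 + 2 + ⋯ + 2 + 1` of `2 k` particles and `k + 1` survivors: particle `0` is
alone, the particles `2 l - 1` and `2 l` go together, and particle `2 k - 1` is alone. -/
def zigzagPattern (k : ℕ) (i : Fin (2 * k)) : Fin (k + 1) :=
  ⟨((i : ℕ) + 1) / 2, by have := i.isLt; omega⟩

/-! The probability is computed as the expectation of `patternDet`, the determinant built from
indicators of the final positions minus a deterministic staircase. Two facts carry the proof.

Pathwise, coalescing particles keep their order (`arratia_le_arratia`), and at ordered positions the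
determinant is exactly the indicator of the coalescence pattern (`det_indicator_sub_staircase`). By
monotonicity this pattern for the particles flanking the walls is the wall-particle pattern
(`containsPattern_iff`).

In expectation, coalescence is invisible to the determinant. Expanding by rows, two particles on one
trajectory contribute equal random rows and hence nothing, so for independent trajectories only the
marginal laws matter (`integral_det_sub`). When two particles meet, the Markov property gives both
trajectories the same future law, so letting one particle follow the other changes nothing. Undoing
the coalescences on a time grid one by one leads to independent particles, whose expected
determinant is that of the coalescence matrix (`integral_patternDet_gridRoot`). Right-continuity and
dominated convergence remove the grid. -/

/-! ### Arratia's construction: first meetings and coalescence -/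

/-- Right-continuity of a path with values in a discrete space. -/
def RightConst {α : Type*} (f : ℝ≥0 → α) : Prop := ∀ t, ∀ᶠ s in 𝓝[≥] t, f s = f t

/-- A set of times that is determined, just after each time `t`, by what happens at `t`,
has a least element. -/
theorem exists_isLeast_of_eventually_iff {S : Set ℝ≥0}
    (hS : ∀ t, ∀ᶠ s in 𝓝[≥] t, (s ∈ S ↔ t ∈ S)) (hne : S.Nonempty) : ∃ u, IsLeast S u := by
  have hglb : IsGLB S (sInf S) := isGLB_csInf hne (OrderBot.bddBelow S)
  -- Points of `S` occur arbitrarily close to the infimum on its right, so membership passes back to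
  -- the infimum itself.
  obtain ⟨s, hs, hiff⟩ := ((hglb.frequently_mem hne).and_eventually (hS _)).exists
  exact ⟨_, hiff.1 hs, hglb.1⟩

/-- Particle `n` meets a particle of higher priority at time `u`. -/
def Meets (η : ℕ → ℝ≥0 → ℤ) (n : ℕ) (u : ℝ≥0) : Prop := ∃ m < n, η n u = arratia η m u

theorem arratia_eq_self {η : ℕ → ℝ≥0 → ℤ} {n : ℕ} {t : ℝ≥0} (h : ∀ u ≤ t, ¬ Meets η n u) :
    arratia η n t = η n t := by
  rw [arratia, dif_neg]
  rintro ⟨m, u, hu, hm, -⟩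
  exact h u hu ⟨m, m.2, hm⟩

/-- The inductive step: the particle follows a particle that it meets at the first meeting time. -/
theorem arratia_eq_of_isLeast_aux {η : ℕ → ℝ≥0 → ℤ} {n : ℕ}
    (ih : ∀ m < n, ∀ m' < n, ∀ u, arratia η m u = arratia η m' u →
      ∀ t ≥ u, arratia η m t = arratia η m' t)
    {u : ℝ≥0} (hu : IsLeast {v | Meets η n v} u) {m : ℕ} (hm : m < n)
    (hmu : η n u = arratia η m u) {t : ℝ≥0} (ht : u ≤ t) : arratia η n t = arratia η m t := by
  have h : ∃ m : Fin n, ∃ u ≤ t, η n u = arratia η m u ∧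
      ∀ v < u, ∀ m' : Fin n, η n v ≠ arratia η m' v :=
    ⟨⟨m, hm⟩, u, ht, hmu, fun v hv m' hv' => hv.not_ge (hu.2 ⟨m', m'.2, hv'⟩)⟩
  rw [arratia, dif_pos h]
  -- The chosen particle may differ from `m`, but it is met at the same first time, so by `ih` the
  -- two have moved together since.
  obtain ⟨u', -, hmu', hu'⟩ := h.choose_spec
  have : u' = u := by
    apply le_antisymm
    · by_contra! hlt
      exact hu' u hlt ⟨m, hm⟩ hmu
    · exact hu.2 ⟨_, h.choose.2, hmu'⟩
  subst this
  exact ih _ h.choose.2 _ hm _ (hmu'.symm.trans hmu) _ ht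

theorem isLeast_meets_aux {η : ℕ → ℝ≥0 → ℤ} (hη : ∀ n, RightConst (η n)) {n : ℕ}
    (ih : ∀ m < n, RightConst (arratia η m)) {t : ℝ≥0} (ht : Meets η n t) :
    ∃ u, IsLeast {v | Meets η n v} u := by
  refine exists_isLeast_of_eventually_iff (fun t => ?_) ⟨t, ht⟩
  have h : ∀ᶠ s in 𝓝[≥] t, ∀ m ∈ Set.Iio n, arratia η m s = arratia η m t :=
    (eventually_all_finite (Set.finite_Iio n)).2 fun m hm => ih m hm t
  filter_upwards [h, hη n t] with s hs hns
  refine exists_congr fun m => and_congr_right fun hm => ?_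
  rw [hns, hs m hm]

/-- Both claims need a single induction: right-continuity of the higher-priority paths provides a
first meeting time, and their coalescence makes the choice of the particle followed immaterial. -/
theorem arratia_aux {η : ℕ → ℝ≥0 → ℤ} (hη : ∀ n, RightConst (η n)) (n : ℕ) :
    RightConst (arratia η n) ∧ ∀ m < n, ∀ u, arratia η n u = arratia η m u →
      ∀ t ≥ u, arratia η n t = arratia η m t := by
  induction n using Nat.strong_induction_on with
  | _ n IH =>
  have ih : ∀ m < n, ∀ m' < n, ∀ u, arratia η m u = arratia η m' u →
      ∀ t ≥ u, arratia η m t = arratia η m' t := by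
    intro m hm m' hm' u h t ht
    rcases lt_trichotomy m m' with hlt | rfl | hlt
    · exact ((IH m' hm').2 m hlt u h.symm t ht).symm
    · rfl
    · exact (IH m hm).2 m' hlt u h t ht
  have hrc : ∀ m < n, RightConst (arratia η m) := fun m hm => (IH m hm).1
  by_cases hmeet : ∃ t, Meets η n t
  · obtain ⟨u, hu⟩ := isLeast_meets_aux hη hrc hmeet.choose_spec
    obtain ⟨m, hm, hmu⟩ := hu.1
    have hbefore : ∀ t < u, arratia η n t = η n t := fun t ht =>
      arratia_eq_self fun v hv hv' => (hv.trans_lt ht).not_ge (hu.2 hv')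
    have hafter : ∀ t ≥ u, arratia η n t = arratia η m t := fun t ht =>
      arratia_eq_of_isLeast_aux ih hu hm hmu ht
    refine ⟨fun t => ?_, fun m' hm' v hv t ht => ?_⟩
    · rcases lt_or_ge t u with htu | htu
      · filter_upwards [hη n t, mem_nhdsWithin_of_mem_nhds (Iio_mem_nhds htu)] with s hs hsu
        rw [hbefore s hsu, hbefore t htu, hs]
      · filter_upwards [hrc m hm t, self_mem_nhdsWithin] with s hs hst
        rw [hafter s (htu.trans hst), hafter t htu, hs]
    · have huv : u ≤ v := by
        by_contra! hlt
        exact hlt.not_ge (hu.2 ⟨m', hm', (hbefore v hlt).symm.trans hv⟩)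
      rw [hafter t (huv.trans ht)]
      exact ih m hm m' hm' v ((hafter v huv).symm.trans hv) t ht
  · have heq : arratia η n = η n :=
      funext fun t => arratia_eq_self fun u _ hu => hmeet ⟨u, hu⟩
    refine ⟨heq ▸ hη n, fun m hm u hu => absurd ⟨u, m, hm, ?_⟩ hmeet⟩
    rw [← hu, heq]

section

variable {η : ℕ → ℝ≥0 → ℤ} (hη : ∀ n, RightConst (η n))
include hη

theorem rightConst_arratia (n : ℕ) : RightConst (arratia η n) := (arratia_aux hη n).1

/-- Particles that have met stay together. -/
theorem arratia_coalesce {m n : ℕ} {u t : ℝ≥0} (h : arratia η m u = arratia η n u) (hut : u ≤ t) :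
    arratia η m t = arratia η n t := by
  rcases lt_trichotomy m n with hlt | rfl | hlt
  · exact ((arratia_aux hη n).2 m hlt u h.symm t hut).symm
  · rfl
  · exact (arratia_aux hη m).2 n hlt u h t hut

theorem exists_isLeast_meets {n : ℕ} {t : ℝ≥0} (ht : Meets η n t) :
    ∃ u, IsLeast {v | Meets η n v} u :=
  isLeast_meets_aux hη (fun m _ => rightConst_arratia hη m) ht

theorem arratia_eq_of_isLeast {n : ℕ} {u : ℝ≥0} (hu : IsLeast {v | Meets η n v} u) {m : ℕ}
    (hm : m < n) (hmu : η n u = arratia η m u) {t : ℝ≥0} (ht : u ≤ t) :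
    arratia η n t = arratia η m t :=
  arratia_eq_of_isLeast_aux (fun _ _ _ _ _ h _ ht => arratia_coalesce hη h ht) hu hm hmu ht

end

/-! ### Coalescence on a discrete time grid -/

open Classical in
/-- Coalescence along a discrete time grid: if trajectory `c` is at `d k c` at grid time `k`, then
`gridRoot d k n` is the trajectory that particle `n` follows after grid time `k`. Particles that
are at the same site at a grid time follow the same trajectory from then on. -/
noncomputable def gridRoot (d : ℕ → ℕ → ℤ) : ℕ → ℕ → ℕ
  | 0, n => n
  | k + 1, n => gridRoot d k (Nat.find (p := fun c => d (k + 1) (gridRoot d k c) =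
      d (k + 1) (gridRoot d k n)) ⟨n, rfl⟩)

theorem gridRoot_succ_position (d : ℕ → ℕ → ℤ) (k n : ℕ) :
    d (k + 1) (gridRoot d (k + 1) n) = d (k + 1) (gridRoot d k n) := by
  classical
  exact Nat.find_spec (p := fun c => d (k + 1) (gridRoot d k c) =
      d (k + 1) (gridRoot d k n)) ⟨n, rfl⟩

/-- The least index in the definition depends on the particle only through its current site. -/
theorem gridRoot_succ_congr {d : ℕ → ℕ → ℤ} {k m n : ℕ}
    (h : d (k + 1) (gridRoot d k m) = d (k + 1) (gridRoot d k n)) :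
    gridRoot d (k + 1) m = gridRoot d (k + 1) n := by
  simp only [gridRoot, h]

theorem gridRoot_eq_of_position_eq {d : ℕ → ℕ → ℤ} (h0 : Function.Injective (d 0)) {k m n : ℕ}
    (h : d k (gridRoot d k m) = d k (gridRoot d k n)) : gridRoot d k m = gridRoot d k n := by
  cases k with
  | zero => exact h0 h
  | succ k =>
    rw [gridRoot_succ_position d, gridRoot_succ_position d] at h
    exact gridRoot_succ_congr h

theorem gridRoot_eq_mono {d : ℕ → ℕ → ℤ} {k l m n : ℕ} (h : gridRoot d k m = gridRoot d k n)
    (hkl : k ≤ l) : gridRoot d l m = gridRoot d l n := by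
  induction l, hkl using Nat.le_induction with
  | base => exact h
  | succ l _ ih => exact gridRoot_succ_congr (by rw [ih])

theorem gridRoot_eq_self {d : ℕ → ℕ → ℤ} {k n : ℕ}
    (h : ∀ l ≤ k, ∀ m < n, d l n ≠ d l (gridRoot d l m)) : gridRoot d k n = n := by
  classical
  induction k with
  | zero => rfl
  | succ k ih =>
    have hk := ih fun l hl => h l (by omega)
    have : Nat.find (p := fun c => d (k + 1) (gridRoot d k c) =
        d (k + 1) (gridRoot d k n)) ⟨n, rfl⟩ = n := by
      rw [Nat.find_eq_iff]
      refine ⟨rfl, fun m hm hm' => h (k + 1) le_rfl m hm ?_⟩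
      rw [gridRoot_succ_position d, hm', hk]
    rw [gridRoot, this, hk]

/-- Only finitely many trajectories are involved in the motion of one particle, which allows
conditioning on countably many histories. -/
theorem gridRoot_le (d : ℕ → ℕ → ℤ) (k n : ℕ) : gridRoot d k n ≤ n := by
  classical
  induction k generalizing n with
  | zero => exact le_rfl
  | succ k ih => exact (ih _).trans (Nat.find_min' _ rfl)

/-- The grid coalescence of the particles `0, …, N - 1` up to grid time `k` only depends on
their positions up to that time. -/
theorem gridRoot_congr {d d' : ℕ → ℕ → ℤ} {N k : ℕ} (h : ∀ l ≤ k, ∀ c < N, d l c = d' l c)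
    {n : ℕ} (hn : n < N) : gridRoot d k n = gridRoot d' k n := by
  classical
  induction k generalizing n with
  | zero => rfl
  | succ k ih =>
    have ih' : ∀ c < N, gridRoot d k c = gridRoot d' k c :=
      fun c hc => ih (fun l hl => h l (by omega)) hc
    have hd : ∀ c < N, d (k + 1) (gridRoot d k c) = d' (k + 1) (gridRoot d' k c) := fun c hc => by
      rw [← ih' c hc]
      exact h _ le_rfl _ ((gridRoot_le d k c).trans_lt hc)
    have hfind : Nat.find (p := fun c => d (k + 1) (gridRoot d k c) =
          d (k + 1) (gridRoot d k n)) ⟨n, rfl⟩ =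
        Nat.find (p := fun c => d' (k + 1) (gridRoot d' k c) =
          d' (k + 1) (gridRoot d' k n)) ⟨n, rfl⟩ := by
      have hle := fun e : ℕ → ℕ → ℤ => Nat.find_min' (p := fun c => e (k + 1) (gridRoot e k c) =
          e (k + 1) (gridRoot e k n)) ⟨n, rfl⟩ rfl
      have hspec := fun e : ℕ → ℕ → ℤ => Nat.find_spec (p := fun c => e (k + 1) (gridRoot e k c) =
          e (k + 1) (gridRoot e k n)) ⟨n, rfl⟩
      apply le_antisymm
      · apply Nat.find_min'
        rw [hd _ ((hle d').trans_lt hn), hd n hn]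
        exact hspec d'
      · apply Nat.find_min'
        rw [← hd _ ((hle d).trans_lt hn), ← hd n hn]
        exact hspec d
    rw [gridRoot, gridRoot, hfind]
    exact ih' _ ((Nat.find_min' (p := fun c => d' (k + 1) (gridRoot d' k c) =
      d' (k + 1) (gridRoot d' k n)) ⟨n, rfl⟩ rfl).trans_lt hn)

/-! ### Refining the grid: convergence to Arratia's construction -/

/-- The `k`-th point of the grid that divides `[0, T]` into `M + 1` parts. -/
noncomputable def gridTime (T : ℝ≥0) (M k : ℕ) : ℝ≥0 := T * k / (M + 1)

theorem gridTime_mono (T : ℝ≥0) (M : ℕ) : Monotone (gridTime T M) := fun k l h => by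
  unfold gridTime; gcongr

theorem gridTime_zero (T : ℝ≥0) (M : ℕ) : gridTime T M 0 = 0 := by simp [gridTime]

theorem gridTime_last (T : ℝ≥0) (M : ℕ) : gridTime T M (M + 1) = T := by
  unfold gridTime
  push_cast
  exact mul_div_cancel_right₀ _ (by positivity)

theorem gridTime_le (T : ℝ≥0) {M k : ℕ} (h : k ≤ M + 1) : gridTime T M k ≤ T :=
  (gridTime_mono T M h).trans_eq (gridTime_last T M)

theorem gridTime_succ (T : ℝ≥0) (M k : ℕ) :
    gridTime T M (k + 1) = gridTime T M k + T / (M + 1) := by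
  unfold gridTime
  push_cast
  ring

theorem eventually_mesh_lt (T : ℝ≥0) {δ : ℝ≥0} (hδ : 0 < δ) :
    ∀ᶠ M : ℕ in atTop, T / (M + 1) < δ := by
  have h : Tendsto (fun M : ℕ => T * (1 / ((M : ℝ≥0) + 1))) atTop (𝓝 (T * 0)) :=
    tendsto_one_div_add_atTop_nhds_zero_nat.const_mul T
  rw [mul_zero] at h
  filter_upwards [h.eventually (gt_mem_nhds hδ)] with M hM
  rwa [div_eq_mul_one_div]

/-- The positions of the trajectories at the grid times. -/
noncomputable def gridPath (T : ℝ≥0) (M : ℕ) (η : ℕ → ℝ≥0 → ℤ) (k c : ℕ) : ℤ := η c (gridTime T M k)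

/-- On a fine enough grid, the discretized coalescing particles agree with the true ones. -/
theorem eventually_gridRoot_eq_arratia {η : ℕ → ℝ≥0 → ℤ} (hη : ∀ n, RightConst (η n))
    (h0 : Function.Injective fun n => η n 0) (T : ℝ≥0) (n : ℕ) :
    ∀ᶠ M in atTop, ∀ k ≤ M + 1, η (gridRoot (gridPath T M η) k n) (gridTime T M k) =
      arratia η n (gridTime T M k) := by
  have h0' : ∀ M, Function.Injective (gridPath T M η 0) := fun M => by
    unfold gridPath; rwa [gridTime_zero]
  induction n using Nat.strong_induction_on with
  | _ n IH =>
  have IH' : ∀ᶠ M in atTop, ∀ m ∈ Set.Iio n, ∀ k ≤ M + 1,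
      η (gridRoot (gridPath T M η) k m) (gridTime T M k) = arratia η m (gridTime T M k) :=
    (eventually_all_finite (Set.finite_Iio n)).2 IH
  have hself : ∀ M, (∀ m ∈ Set.Iio n, ∀ k ≤ M + 1,
      η (gridRoot (gridPath T M η) k m) (gridTime T M k) = arratia η m (gridTime T M k)) →
      ∀ k ≤ M + 1, (∀ u ≤ gridTime T M k, ¬ Meets η n u) →
        gridRoot (gridPath T M η) k n = n := by
    intro M hM k hk hnot
    refine gridRoot_eq_self fun l hl m hm heq => hnot _ (gridTime_mono T M hl) ⟨m, hm, ?_⟩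
    exact heq.trans (hM m hm l (hl.trans hk))
  by_cases hmeet : ∃ t ≤ T, Meets η n t
  · obtain ⟨t, htT, ht⟩ := hmeet
    obtain ⟨τ, hτ⟩ := exists_isLeast_meets hη ht
    obtain ⟨m, hm, hmτ⟩ := hτ.1
    obtain ⟨σ, hσ, hτσ⟩ : ∃ σ > τ, Set.Ico τ σ ⊆ {s | η n s = arratia η m s} := by
      have h : {s | η n s = arratia η m s} ∈ 𝓝[≥] τ := by
        filter_upwards [hη n τ, rightConst_arratia hη m τ] with s h1 h2
        exact h1.trans (hmτ.trans h2.symm)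
      rwa [mem_nhdsGE_iff_exists_Ico_subset] at h
    filter_upwards [IH', eventually_mesh_lt T (tsub_pos_of_lt hσ)] with M hM hmesh k hk
    have hbefore : ∀ k ≤ M + 1, gridTime T M k < τ → gridRoot (gridPath T M η) k n = n :=
      fun k hk hkτ => hself M hM k hk fun u hu hu' => (hu.trans_lt hkτ).not_ge (hτ.2 hu')
    rcases lt_or_ge (gridTime T M k) τ with hkτ | hkτ
    · rw [hbefore k hk hkτ, arratia_eq_self]
      exact fun u hu hu' => (hu.trans_lt hkτ).not_ge (hτ.2 hu')
    · classical
      have hex : ∃ k, τ ≤ gridTime T M k := ⟨k, hkτ⟩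
      -- The first grid time at or after `τ`. Since the mesh is below `σ - τ`, it lies in `[τ, σ)`,
      -- while the trajectory of `n` still agrees with particle `m`; so the grid version notices the
      -- meeting.
      obtain ⟨l, hl, hmin⟩ : ∃ l, τ ≤ gridTime T M l ∧ ∀ l' < l, gridTime T M l' < τ :=
        ⟨Nat.find hex, Nat.find_spec hex, fun l' hl' => not_le.1 (Nat.find_min hex hl')⟩
      have hlk : l ≤ k := by
        by_contra! hlt
        exact (hmin k hlt).not_ge hkτ
      have hroot : gridRoot (gridPath T M η) l n = gridRoot (gridPath T M η) l m := by
        apply gridRoot_eq_of_position_eq (h0' M)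
        have hpos : gridTime T M l < σ →
            gridPath T M η l n = gridPath T M η l (gridRoot (gridPath T M η) l m) := by
          intro hlσ
          exact (hτσ ⟨hl, hlσ⟩ : η n _ = _).trans (hM m hm l (hlk.trans hk)).symm
        cases l with
        | zero =>
          refine hpos ?_
          rw [gridTime_zero]
          exact (zero_le (a := τ)).trans_lt hσ
        | succ l =>
          rw [gridRoot_succ_position (gridPath T M η), hbefore l (by omega) (hmin l (by omega))]
          refine hpos ?_
          rw [gridTime_succ]
          calc gridTime T M l + T / (M + 1) < τ + (σ - τ) :=
                add_lt_add (hmin l (by omega)) hmesh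
            _ = σ := add_tsub_cancel_of_le hσ.le
      rw [gridRoot_eq_mono hroot hlk, hM m hm k hk]
      exact (arratia_eq_of_isLeast hη hτ hm hmτ hkτ).symm
  · push Not at hmeet
    filter_upwards [IH'] with M hM k hk
    have h := fun u (hu : u ≤ gridTime T M k) => hmeet u (hu.trans (gridTime_le T hk))
    rw [hself M hM k hk h, arratia_eq_self h]

/-! ### Expected determinants of independent variables -/

/-- Multilinearity in the rows. The random rows must be separated from the deterministic ones,
because particles sharing a trajectory have equal rows in `v` but not in `v - s`. -/
theorem det_sub_eq_sum {n : ℕ} (v s : Matrix (Fin n) (Fin n) ℝ) :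
    (v - s).det =
      ∑ S : Finset (Fin n), (Matrix.of fun i j => if i ∈ S then v i j else -s i j).det := by
  have h := (Matrix.detRowAlternating (n := Fin n) (R := ℝ)).map_add_univ v (-s)
  rw [sub_eq_add_neg]
  refine h.trans (Finset.sum_congr rfl fun S _ => ?_)
  refine congrArg Matrix.detRowAlternating ?_
  funext i j
  simp only [Finset.piecewise, Matrix.of_apply]
  split_ifs <;> rfl

theorem det_ite_eq_sum {n : ℕ} (S : Finset (Fin n)) (v s : Matrix (Fin n) (Fin n) ℝ) :
    (Matrix.of fun i j => if i ∈ S then v i j else -s i j).det =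
      ∑ σ : Equiv.Perm (Fin n), (Equiv.Perm.sign σ : ℝ) *
        ((∏ i ∈ S, v i (σ i)) * ∏ i ∈ Sᶜ, -s i (σ i)) := by
  rw [← Matrix.det_transpose, Matrix.det_apply']
  refine Finset.sum_congr rfl fun σ _ => ?_
  rw [← Finset.prod_mul_prod_compl S]
  congr 2
  · exact Finset.prod_congr rfl fun i hi => by simp [Matrix.transpose_apply, hi]
  · exact Finset.prod_congr rfl fun i hi => by
      simp [Matrix.transpose_apply, Finset.mem_compl.1 hi]

/-- Expanding a determinant in the rows: since equal rows do not contribute twice, the expectation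
of the determinant only depends on the marginal laws of the `W c`, even if some of the rows
share the same random variable. -/
theorem integral_det_sub {Ω E ι : Type*} [MeasurableSpace Ω] [MeasurableSpace E] {ν : Measure Ω}
    {W : ι → Ω → E} (hW : iIndepFun W ν) (hWm : ∀ c, Measurable (W c))
    {n : ℕ} (r : Fin n → ι) {f : Fin n → E → ℝ} (hf : ∀ j, Measurable (f j))
    (hb : ∀ j x, |f j x| ≤ 1) (s : Matrix (Fin n) (Fin n) ℝ) :
    ∫ ω, (Matrix.of (fun i j => f j (W (r i) ω)) - s).det ∂ν =
      (Matrix.of (fun i j => ∫ ω, f j (W (r i) ω) ∂ν) - s).det := by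
  have := hW.isProbabilityMeasure
  have hint : ∀ (S : Finset (Fin n)) (σ : Equiv.Perm (Fin n)),
      Integrable (fun ω => (Equiv.Perm.sign σ : ℝ) *
        ((∏ i ∈ S, f (σ i) (W (r i) ω)) * ∏ i ∈ Sᶜ, -s i (σ i))) ν := by
    intro S σ
    refine Integrable.const_mul (Integrable.mul_const ?_ _) _
    refine Integrable.of_bound (C := 1) (Measurable.aestronglyMeasurable ?_) (ae_of_all _ fun ω => ?_)
    · exact Finset.measurable_prod _ fun i _ => (hf _).comp (hWm _)
    · rw [Real.norm_eq_abs, Finset.abs_prod]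
      exact Finset.prod_le_one (fun _ _ => abs_nonneg _) fun _ _ => hb _ _
  simp_rw [det_sub_eq_sum]
  rw [integral_finsetSum]
  swap
  · intro S _
    simp_rw [det_ite_eq_sum]
    exact integrable_finsetSum _ fun σ _ => hint S σ
  refine Finset.sum_congr rfl fun S _ => ?_
  by_cases hinj : Set.InjOn r S
  · simp_rw [det_ite_eq_sum]
    simp only [Matrix.of_apply]
    rw [integral_finsetSum _ fun σ _ => hint S σ]
    refine Finset.sum_congr rfl fun σ _ => ?_
    rw [integral_const_mul, integral_mul_const]
    congr 2
    have h1 : iIndepFun (fun (i : S) ω => f (σ i) (W (r i) ω)) ν :=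
      (hW.precomp (g := fun i : S => r i) hinj.injective).comp (fun i : S => f (σ i))
        fun i => hf _
    have h2 := h1.integral_fun_prod_eq_prod_integral
      fun i => ((hf _).comp (hWm _)).aestronglyMeasurable
    simp_rw [← Finset.prod_coe_sort S]
    exact h2
  -- Two selected rows share a variable: they are equal both before and after taking expectations,
  -- so both sides vanish.
  · obtain ⟨i, hi, i', hi', hr, hne⟩ : ∃ i ∈ S, ∃ i' ∈ S, r i = r i' ∧ i ≠ i' := by
      simpa [Set.InjOn] using hinj
    have key : ∀ v : Matrix (Fin n) (Fin n) ℝ, v i = v i' →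
        (Matrix.of fun i j => if i ∈ S then v i j else -s i j).det = 0 := fun v hv =>
      Matrix.det_zero_of_row_eq hne (by ext j; simp [hi, hi', hv])
    rw [key _ (by ext j; simp [hr])]
    simp_rw [fun ω => key (Matrix.of fun i j => f j (W (r i) ω)) (by ext j; simp [hr])]
    simp

/-! ### The determinant as indicator of a coalescence pattern -/

/-- A determinant vanishes if the matrix has a zero block that is too large. -/
theorem det_eq_zero_of_block {n : ℕ} (M : Matrix (Fin n) (Fin n) ℝ) (R C : Finset (Fin n))
    (hcard : n < R.card + C.card) (h : ∀ i ∈ R, ∀ j ∈ C, M i j = 0) : M.det = 0 := by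
  rw [← Matrix.det_transpose, Matrix.det_apply']
  refine Finset.sum_eq_zero fun σ _ => ?_
  obtain ⟨j, hj⟩ : (R.image σ ∩ C).Nonempty := by
    rw [← Finset.card_pos]
    have h1 := Finset.card_union_add_card_inter (R.image σ) C
    have h2 := Finset.card_le_univ (R.image σ ∪ C)
    rw [Finset.card_image_of_injective _ σ.injective] at h1
    rw [Fintype.card_fin] at h2
    omega
  obtain ⟨hj1, hjC⟩ := Finset.mem_inter.1 hj
  obtain ⟨i, hi, rfl⟩ := Finset.mem_image.1 hj1
  rw [Finset.prod_eq_zero (Finset.mem_univ i) (by simpa using h i hi _ hjC), mul_zero]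

open Classical in
/-- The columns of the coalescence matrix of a particle configuration: `x` is counted in
column `j` if it is at (or, unless `j` is the first of its block, to the left of) `y (b j)`. -/
def columnSet {n m : ℕ} (b : Fin n → Fin m) (y : Fin m → ℤ) (j : Fin n) : Set ℤ :=
  if ∃ j' < j, b j' = b j then Set.Iic (y (b j)) else {y (b j)}

open Classical in
/-- The staircase that is subtracted in the coalescence matrix. -/
noncomputable def staircase {n m : ℕ} (b : Fin n → Fin m) : Matrix (Fin n) (Fin n) ℝ :=
  Matrix.of fun i j => if (∃ j' < j, b j' = b j) ∧ i < j then 1 else 0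

open Classical in
/-- For particles at ordered final positions, the determinant is the indicator of the
coalescence pattern. -/
theorem det_indicator_sub_staircase {n m : ℕ} {b : Fin n → Fin m} (hb : Monotone b)
    {y : Fin m → ℤ} (hy : StrictMono y) {x : Fin n → ℤ} (hx : Monotone x) :
    (Matrix.of (fun i j => (columnSet b y j).indicator (1 : ℤ → ℝ) (x i)) - staircase b).det =
      if ∀ i, x i = y (b i) then 1 else 0 := by
  split_ifs with h
  -- The diagonal is 1. Above it, the staircase cancels the 1 in the half-line columns, and a
  -- one-point column belongs to a later block.
  · rw [Matrix.det_of_isLowerTriangular]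
    · refine Finset.prod_eq_one fun i _ => ?_
      by_cases hi : ∃ j' < i, b j' = b i <;> simp [columnSet, staircase, hi, h]
    · intro i j (hij : i < j)
      by_cases hj : ∃ j' < j, b j' = b j
      · simp [columnSet, staircase, hj, h, hij, hy.le_iff_le, hb hij.le]
      · have : b i ≠ b j := fun h' => hj ⟨i, hij, h'⟩
        simp [columnSet, staircase, hj, h, hy.injective.eq_iff, this]
  · push Not at h
    obtain ⟨i, hi⟩ := h
    rcases lt_or_gt_of_ne hi with hlt | hgt
    -- Particle `i` is too far left. With `j` the first of its block, the rows up to `j` and the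
    -- columns from `j` on form a zero block, of `j + 1` rows and `n - j` columns. Column `j` has no
    -- staircase, so its diagonal entry vanishes too.
    · obtain ⟨j, hj, hjmin⟩ : ∃ j, b j = b i ∧ ∀ j' < j, b j' ≠ b j := by
        have hne : (Finset.univ.filter fun j => b j = b i).Nonempty := ⟨i, by simp⟩
        refine ⟨_, (Finset.mem_filter.1 (Finset.min'_mem _ hne)).2, fun j' hj' h' => ?_⟩
        refine hj'.not_ge (Finset.min'_le _ _ ?_)
        simp [h', (Finset.mem_filter.1 (Finset.min'_mem _ hne)).2]
      have hji : j ≤ i := by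
        by_contra! hij
        exact hjmin i hij hj.symm
      refine det_eq_zero_of_block _ (Finset.Iic j) (Finset.Ici j) ?_ fun i' hi' j' hj' => ?_
      · simp only [Fin.card_Iic, Fin.card_Ici]; omega
      · rw [Finset.mem_Iic] at hi'
        rw [Finset.mem_Ici] at hj'
        have hlt' : x i' < y (b j') :=
          ((hx (hi'.trans hji)).trans_lt hlt).trans_le (hy.monotone (hj ▸ hb hj'))
        by_cases hf : ∃ j'' < j', b j'' = b j'
        · have : i' < j' := by
            rcases hj'.lt_or_eq with h1 | rfl
            · exact hi'.trans_lt h1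
            · exact absurd hf (by push Not; exact hjmin)
          simp [columnSet, staircase, hf, this, hlt'.le]
        · simp [columnSet, staircase, hf, hlt'.ne]
    -- Particle `i` is too far right: the rows from `i` on miss all column sets up to `i`, and the
    -- staircase is zero on this block.
    · refine det_eq_zero_of_block _ (Finset.Ici i) (Finset.Iic i) ?_ fun i' hi' j' hj' => ?_
      · simp only [Fin.card_Iic, Fin.card_Ici]; omega
      · rw [Finset.mem_Ici] at hi'
        rw [Finset.mem_Iic] at hj'
        have hlt' : y (b j') < x i' := ((hy.monotone (hb hj')).trans_lt hgt).trans_le (hx hi')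
        by_cases hf : ∃ j'' < j', b j'' = b j'
        · simp [columnSet, staircase, hf, (hj'.trans hi').not_gt, hlt'.not_ge]
        · simp [columnSet, staircase, hf, hlt'.ne']

/-! ### Order preservation from skip-freeness -/

section

variable {η : ℕ → ℝ≥0 → ℤ} (hη : ∀ n, RightConst (η n))
  (h0 : Function.Injective fun n => η n 0)
  (hskip : ∀ m n, η m 0 < η n 0 → ∀ t, (∀ u ≤ t, η m u ≠ η n u) → η m t < η n t)
include hη h0 hskip

/-- As long as it has not met any other particle, a particle keeps its order
with respect to the particles of higher priority. -/
theorem lt_iff_lt_arratia {n m : ℕ} (hmn : m < n) {u : ℝ≥0} (hnot : ∀ v < u, ¬ Meets η n v)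
    (hne : η n u ≠ arratia η m u) : η n 0 < η m 0 ↔ η n u < arratia η m u := by
  induction m using Nat.strong_induction_on generalizing u with
  | _ m IH =>
  have hdirect : ∀ u, (∀ v < u, ¬ Meets η n v) → η n u ≠ arratia η m u →
      (∀ v ≤ u, arratia η m v = η m v) → (η n 0 < η m 0 ↔ η n u < arratia η m u) := by
    intro u hnot hne heq
    have hmeet : ∀ v ≤ u, η n v ≠ η m v := by
      intro v hv
      rw [← heq v hv]
      rcases hv.lt_or_eq with hv | rfl
      · exact fun h => hnot v hv ⟨m, hmn, h⟩
      · exact hne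
    rw [heq u le_rfl]
    refine ⟨fun h => hskip n m h u hmeet, fun h => ?_⟩
    by_contra! hle
    have hlt : η m 0 < η n 0 := hle.lt_of_ne fun h => hmn.ne (h0 h)
    exact (hskip m n hlt u fun v hv => (hmeet v hv).symm).not_gt h
  by_cases hm : ∃ v ≤ u, Meets η m v
  · obtain ⟨v, hvu, hv⟩ := hm
    obtain ⟨σ, hσ⟩ := exists_isLeast_meets hη hv
    have hσu : σ ≤ u := (hσ.2 hv).trans hvu
    obtain ⟨m', hm', hσm'⟩ := hσ.1
    have hafter : ∀ t, σ ≤ t → arratia η m t = arratia η m' t := fun t ht =>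
      arratia_eq_of_isLeast hη hσ hm' hσm' ht
    have hneσ : η n σ ≠ arratia η m σ := by
      rcases hσu.lt_or_eq with h | rfl
      · exact fun h' => hnot σ h ⟨m, hmn, h'⟩
      · exact hne
    have hnotσ : ∀ v < σ, ¬ Meets η n v := fun v hv => hnot v (hv.trans_le hσu)
    -- Until `σ`, `m` is on its own trajectory; afterwards it moves with `m'`. The initial order of
    -- `n` and `m'` links the orders at `σ` and at `u`.
    have e1 := hdirect σ hnotσ hneσ fun v hv => by
      rcases hv.lt_or_eq with hv | rfl
      · exact arratia_eq_self fun w hw hw' => (hw.trans_lt hv).not_ge (hσ.2 hw')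
      · rw [hafter v le_rfl, hσm']
    have e2 := IH m' hm' (hm'.trans hmn) hnotσ (hafter σ le_rfl ▸ hneσ)
    have e3 := IH m' hm' (hm'.trans hmn) hnot (hafter u hσu ▸ hne)
    rw [e1, hafter σ le_rfl, ← e2, e3, hafter u hσu]
  · push Not at hm
    exact hdirect u hnot hne fun v hv => arratia_eq_self fun w hw => hm w (hw.trans hv)

/-- Coalescing particles keep their order. -/
theorem arratia_le_arratia {m n : ℕ} (hmn : η m 0 < η n 0) (t : ℝ≥0) :
    arratia η m t ≤ arratia η n t := by
  suffices H : ∀ N, ∀ m < N, ∀ n < N, η m 0 < η n 0 → ∀ t, arratia η m t ≤ arratia η n t from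
    H (max m n + 1) m (by omega) n (by omega) hmn t
  intro N
  induction N with
  | zero => intro m hm; omega
  | succ N IH =>
  have key : ∀ m < N, ∀ t, arratia η N t = arratia η m t ∨
      (η N 0 < η m 0 ∧ arratia η N t ≤ arratia η m t) ∨
      (η m 0 < η N 0 ∧ arratia η m t ≤ arratia η N t) := by
    intro m hm t
    have hne0 : η N 0 ≠ η m 0 := fun h => hm.ne' (h0 h)
    by_cases hmeet : ∃ v ≤ t, Meets η N v
    · obtain ⟨v, hvt, hv⟩ := hmeet
      obtain ⟨τ, hτ⟩ := exists_isLeast_meets hη hv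
      have hτt : τ ≤ t := (hτ.2 hv).trans hvt
      obtain ⟨m', hm', hm'τ⟩ := hτ.1
      by_cases hmτ : η N τ = arratia η m τ
      · exact Or.inl (arratia_eq_of_isLeast hη hτ hm hmτ hτt)
      right
      -- At `τ` particle `N` is where `m'` is, so the order of `m'` and `m` at `τ` is the initial
      -- order of `N` and `m`. By `IH` it is also the initial order of `m'` and `m`, hence persists
      -- weakly until `t`.
      have h1 := lt_iff_lt_arratia hη h0 hskip hm
        (fun w hw hw' => hw.not_ge (hτ.2 hw')) hmτ
      rw [arratia_eq_of_isLeast hη hτ hm' hm'τ hτt]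
      rw [hm'τ] at h1 hmτ
      have hmm' : η m' 0 ≠ η m 0 := fun h => hmτ (by rw [h0 h])
      rcases hne0.lt_or_gt with h | h
      · refine Or.inl ⟨h, IH m' hm' m hm ?_ t⟩
        by_contra! hle
        exact (IH m hm m' hm' (hle.lt_of_ne hmm'.symm) τ).not_gt (h1.1 h)
      · refine Or.inr ⟨h, IH m hm m' hm' ?_ t⟩
        by_contra! hle
        have := IH m' hm' m hm (hle.lt_of_ne hmm') τ
        exact h.not_gt (h1.2 (this.lt_of_ne hmτ))
    · push Not at hmeet
      right
      have hne : η N t ≠ arratia η m t := fun h => hmeet t le_rfl ⟨m, hm, h⟩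
      have h1 := lt_iff_lt_arratia hη h0 hskip hm (fun w hw => hmeet w hw.le) hne
      rw [arratia_eq_self hmeet]
      rcases hne0.lt_or_gt with h | h
      · exact Or.inl ⟨h, (h1.1 h).le⟩
      · exact Or.inr ⟨h, not_lt.1 fun h' => h.not_gt (h1.2 h')⟩
  intro m hm n hn hmn t
  rcases Nat.lt_succ_iff_lt_or_eq.1 hm with hm | rfl <;>
    rcases Nat.lt_succ_iff_lt_or_eq.1 hn with hn | rfl
  · exact IH m hm n hn hmn t
  · rcases key m hm t with h | h | h
    · exact h.ge
    · exact absurd h.1 hmn.not_gt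
    · exact h.2
  · rcases key n hn t with h | h | h
    · exact h.le
    · exact h.2
    · exact absurd h.1 hmn.not_gt
  · exact absurd hmn (lt_irrefl _)

end

/-! ### Pattern determinants and the Markov property -/

/-- The determinant whose expectation detects a coalescence pattern, as a function of the
final positions of the particles. -/
noncomputable def patternDet {n m : ℕ} (b : Fin n → Fin m) (y : Fin m → ℤ) (w : Fin n → ℤ) : ℝ :=
  (Matrix.of (fun i j => (columnSet b y j).indicator (1 : ℤ → ℝ) (w i)) - staircase b).det

theorem abs_indicator_one_le {α : Type*} (V : Set α) (x : α) :
    |V.indicator (1 : α → ℝ) x| ≤ 1 := by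
  classical
  rw [Set.indicator_apply]
  split_ifs <;> simp

theorem abs_patternDet_le {n m : ℕ} (b : Fin n → Fin m) (y : Fin m → ℤ) (w : Fin n → ℤ) :
    |patternDet b y w| ≤ n.factorial * 2 ^ n := by
  classical
  have h := Matrix.det_le (abv := AbsoluteValue.abs (S := ℝ)) (x := 2)
    (A := Matrix.of (fun i j => (columnSet b y j).indicator (1 : ℤ → ℝ) (w i)) - staircase b)
    fun i j => by
      rw [AbsoluteValue.abs_apply, Matrix.sub_apply, Matrix.of_apply]
      refine (abs_sub _ _).trans ?_
      have h1 := abs_indicator_one_le (columnSet b y j) (w i)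
      have h2 : |staircase b i j| ≤ 1 := by
        unfold staircase
        rw [Matrix.of_apply]
        split_ifs <;> simp
      linarith
  rw [nsmul_eq_mul, Fintype.card_fin] at h
  exact h

theorem integrable_patternDet {Ω : Type*} [MeasurableSpace Ω] {ν : Measure Ω} [IsFiniteMeasure ν]
    {n m : ℕ} (b : Fin n → Fin m) (y : Fin m → ℤ) {w : Ω → Fin n → ℤ} (hw : Measurable w) :
    Integrable (fun ω => patternDet b y (w ω)) ν :=
  Integrable.of_bound (((measurable_of_countable (patternDet b y)).comp hw).aestronglyMeasurable)
    (n.factorial * 2 ^ n) (ae_of_all _ fun _ => abs_patternDet_le b y _)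

/-- Injectivity of `r` is not required: after coalescence several particles follow one trajectory.
-/
theorem integral_patternDet {Ω ι : Type*} [MeasurableSpace Ω] {ν : Measure Ω}
    {W : ι → Ω → ℤ} (hW : iIndepFun W ν) (hWm : ∀ c, Measurable (W c))
    {n m : ℕ} (r : Fin n → ι) (b : Fin n → Fin m) (y : Fin m → ℤ) :
    ∫ ω, patternDet b y (fun i => W (r i) ω) ∂ν =
      (Matrix.of (fun i j => ν.real (W (r i) ⁻¹' columnSet b y j)) - staircase b).det := by
  unfold patternDet
  rw [integral_det_sub hW hWm r (f := fun j => (columnSet b y j).indicator 1)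
    (fun j => measurable_of_countable _) fun j x => abs_indicator_one_le _ x]
  congr 2
  ext i j
  rw [Matrix.of_apply, Matrix.of_apply, ← integral_indicator_one ((hWm _) (.of_discrete))]
  rfl

/-- The Markov property, at the present time `τ (Fin.last k)`. -/
theorem IsMarkovProcessFrom.markov {Ω : Type*} [MeasurableSpace Ω] {μ : Measure Ω}
    {p : ℝ≥0 → ℝ≥0 → ℤ → ℤ → ℝ} {x : ℤ} {ξ : ℝ≥0 → Ω → ℤ} (h : IsMarkovProcessFrom μ p x ξ)
    {k : ℕ} {τ : Fin (k + 1) → ℝ≥0} (hτ : Monotone τ) (hτ0 : τ 0 = 0) {T : ℝ≥0}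
    (hT : τ (Fin.last k) ≤ T) {z : Fin (k + 1) → ℤ} (hz : z 0 = x) (v : ℤ) :
    μ.real ({ω | ∀ i, ξ (τ i) ω = z i} ∩ {ω | ξ T ω = v}) =
      μ.real {ω | ∀ i, ξ (τ i) ω = z i} * p (τ (Fin.last k)) T (z (Fin.last k)) v := by
  rw [h.fdd k τ z hτ hτ0 hz]
  have h1 := h.fdd (k + 1) (Fin.snoc (α := fun _ => ℝ≥0) τ T) (Fin.snoc (α := fun _ => ℤ) z v)
    (by
      intro i j hij
      induction j using Fin.lastCases with
      | last =>
        rw [Fin.snoc_last]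
        induction i using Fin.lastCases with
        | last => rw [Fin.snoc_last]
        | cast i => rw [Fin.snoc_castSucc]; exact (hτ (Fin.le_last i)).trans hT
      | cast j =>
        induction i using Fin.lastCases with
        | last => exact absurd hij (by simp)
        | cast i =>
          rw [Fin.snoc_castSucc, Fin.snoc_castSucc]
          exact hτ (Fin.castSucc_le_castSucc_iff.1 hij))
    (by rw [← Fin.castSucc_zero, Fin.snoc_castSucc, hτ0])
    (by rw [← Fin.castSucc_zero, Fin.snoc_castSucc, hz])
  rw [Fin.prod_univ_castSucc] at h1
  simp only [Fin.succ_castSucc, Fin.snoc_castSucc, Fin.succ_last, Fin.snoc_last] at h1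
  rw [← h1]
  congr 1
  ext ω
  refine Iff.symm (Fin.forall_fin_succ'.trans ?_)
  simp only [Fin.snoc_castSucc, Fin.snoc_last]
  rfl

theorem IsMarkovProcessFrom.real_eq {Ω : Type*} [MeasurableSpace Ω] {μ : Measure Ω}
    [IsProbabilityMeasure μ]
    {p : ℝ≥0 → ℝ≥0 → ℤ → ℤ → ℝ} {x : ℤ} {ξ : ℝ≥0 → Ω → ℤ} (h : IsMarkovProcessFrom μ p x ξ)
    (T : ℝ≥0) (v : ℤ) : μ.real (ξ T ⁻¹' {v}) = p 0 T x v := by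
  have h1 := h.markov (k := 0) (τ := fun _ => 0) (fun _ _ _ => le_rfl) rfl (T := T) (zero_le)
    (z := fun _ => x) rfl v
  have h2 : {ω | ∀ _ : Fin 1, ξ 0 ω = x} = Set.univ := by
    ext ω; simp [h.start]
  rw [h2, Set.univ_inter, probReal_univ, one_mul] at h1
  exact h1

/-! ### Invariance of the expectation under grid coalescence -/

section

variable {Ω : Type*} [MeasurableSpace Ω] {μ : Measure Ω}
  {p : ℝ≥0 → ℝ≥0 → ℤ → ℤ → ℝ} {η : ℕ → ℝ≥0 → Ω → ℤ} {x : ℕ → ℤ}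
  (hη : ∀ n, IsMarkovProcessFrom μ p (x n) (η n))
include hη

/-- The root factors through finitely many integer positions, a countable space. -/
theorem measurable_gridRoot (T : ℝ≥0) (M k n : ℕ) :
    Measurable fun ω => gridRoot (gridPath T M fun c t => η c t ω) k n := by
  classical
  let H : Ω → (Fin (k + 1) × Fin (n + 1) → ℤ) := fun ω q => η q.2 (gridTime T M q.1) ω
  have hH : Measurable H := measurable_pi_lambda _ fun q => (hη _).measurable _
  let G : (Fin (k + 1) × Fin (n + 1) → ℤ) → ℕ := fun h =>
    gridRoot (fun l c => if hlc : l < k + 1 ∧ c < n + 1 then h (⟨l, hlc.1⟩, ⟨c, hlc.2⟩) else 0) k n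
  have : (fun ω => gridRoot (gridPath T M fun c t => η c t ω) k n) = G ∘ H := by
    ext ω
    refine gridRoot_congr (N := n + 1) (fun l hl c hc => ?_) (Nat.lt_succ_self n)
    rw [dif_pos ⟨by omega, hc⟩]
    rfl
  rw [this]
  exact (measurable_of_countable G).comp hH

theorem measurable_gridRoot_position (T : ℝ≥0) (M k n : ℕ) :
    Measurable fun ω => η (gridRoot (gridPath T M fun c t => η c t ω) k n) T ω := by
  have h : Measurable fun q : Ω × ℕ => η q.2 T q.1 :=
    measurable_from_prod_countable_left fun n => (hη n).measurable T
  exact h.comp (measurable_id.prodMk (measurable_gridRoot hη T M k n))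

variable [IsProbabilityMeasure μ] (hindep : iIndepFun (fun n ω t => η n t ω) μ)
include hindep

/-- Given the history of finitely many independent particles, the expectation of a pattern
determinant in the future does not change when a particle follows another one that is currently
at the same site. -/
theorem setIntegral_patternDet_congr {N k : ℕ} {τ : Fin (k + 1) → ℝ≥0} (hτ : Monotone τ)
    (hτ0 : τ 0 = 0) {T : ℝ≥0} (hT : τ (Fin.last k) ≤ T) (z : Fin N → Fin (k + 1) → ℤ)
    {n m : ℕ} (b : Fin n → Fin m) (y : Fin m → ℤ) {r r' : Fin n → Fin N}
    (hr : ∀ i, z (r i) (Fin.last k) = z (r' i) (Fin.last k)) :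
    ∫ ω in {ω | ∀ c : Fin N, ∀ l, η c (τ l) ω = z c l}, patternDet b y (fun i => η (r i) T ω) ∂μ =
      ∫ ω in {ω | ∀ c : Fin N, ∀ l, η c (τ l) ω = z c l},
        patternDet b y (fun i => η (r' i) T ω) ∂μ := by
  let Y : Fin N → Ω → (Fin (k + 1) → ℤ) := fun c ω l => η c (τ l) ω
  let W : Fin N → Ω → ℤ := fun c ω => η c T ω
  have hY : ∀ c, Measurable (Y c) := fun c => measurable_pi_lambda _ fun l => (hη c).measurable _
  have hW : ∀ c, Measurable (W c) := fun c => (hη c).measurable _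
  set A : Set Ω := {ω | ∀ c : Fin N, ∀ l, η c (τ l) ω = z c l} with hA
  have hAY : A = ⋂ c, Y c ⁻¹' {z c} := by
    ext ω
    simp [hA, Y, funext_iff]
  rcases eq_or_ne (μ A) 0 with h0 | h0
  · rw [setIntegral_measure_zero _ h0, setIntegral_measure_zero _ h0]
  have hy : ∀ c, μ (Y c ⁻¹' {z c}) ≠ 0 := fun c hc =>
    h0 (measure_mono_null (hAY ▸ Set.iInter_subset _ c) hc)
  have hpair : iIndepFun (fun (c : Fin N) ω => (W c ω, Y c ω)) μ :=
    (hindep.precomp Fin.val_injective).comp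
      (fun _ (f : ℝ≥0 → ℤ) => (f T, fun l => f (τ l))) fun _ =>
        (measurable_pi_apply T).prodMk (measurable_pi_lambda _ fun l => measurable_pi_apply _)
  have hcond : iIndepFun W μ[|A] := by
    rw [hAY]
    exact hpair.cond hY hy fun c => .singleton _
  have hlaw : ∀ c v, μ[|A].real (W c ⁻¹' {v}) = p (τ (Fin.last k)) T (z c (Fin.last k)) v := by
    intro c v
    -- By independence, the histories of the other trajectories do not affect the law of this one.
    have h1 : μ[W c ⁻¹' {v} | A] = μ[W c ⁻¹' {v} | Y c ⁻¹' {z c}] := by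
      rw [hAY]
      have := cond_iInter hY hpair (s := {c}) (f := fun c => W c ⁻¹' {v}) (t := fun c => {z c})
        (fun i _ => ⟨{v}, .singleton _, rfl⟩) (fun i _ => hy i) fun c => .singleton _
      simpa using this
    have hz : z c 0 = x c := by
      obtain ⟨ω, hω⟩ := nonempty_of_measure_ne_zero (hy c)
      have : Y c ω 0 = z c 0 := congrFun hω 0
      rw [← this, ← (hη c).start ω, ← hτ0]
    have h2 := (hη c).markov hτ hτ0 hT hz v
    have hset : {ω | ∀ i, η c (τ i) ω = z c i} = Y c ⁻¹' {z c} := by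
      ext ω; simp [Y, funext_iff]
    rw [hset] at h2
    have hne : μ.real (Y c ⁻¹' {z c}) ≠ 0 :=
      (ENNReal.toReal_ne_zero.2 ⟨hy c, measure_ne_top _ _⟩)
    rw [measureReal_def, h1, cond_apply (hY c (.singleton _)), ENNReal.toReal_mul,
      ENNReal.toReal_inv]
    change (μ.real _)⁻¹ * μ.real _ = _
    rw [inv_mul_eq_iff_eq_mul₀ hne]
    exact h2
  have : IsProbabilityMeasure μ[|A] := cond_isProbabilityMeasure h0
  have hmap : ∀ c c', z c (Fin.last k) = z c' (Fin.last k) →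
      μ[|A].map (W c) = μ[|A].map (W c') := by
    intro c c' h
    refine Measure.ext_of_singleton fun v => ?_
    rw [Measure.map_apply (hW c) (.singleton _), Measure.map_apply (hW c') (.singleton _)]
    rw [← ENNReal.toReal_eq_toReal_iff' (measure_ne_top _ _) (measure_ne_top _ _)]
    change μ[|A].real _ = μ[|A].real _
    rw [hlaw, hlaw, h]
  have hcongr : ∫ ω, patternDet b y (fun i => W (r i) ω) ∂μ[|A] =
      ∫ ω, patternDet b y (fun i => W (r' i) ω) ∂μ[|A] := by
    rw [integral_patternDet hcond hW, integral_patternDet hcond hW]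
    congr 2
    ext i j
    simp only [Matrix.of_apply]
    rw [measureReal_def, measureReal_def, ← Measure.map_apply (hW _) .of_discrete,
      ← Measure.map_apply (hW _) .of_discrete, hmap _ _ (hr i)]
  rw [ProbabilityTheory.cond, integral_smul_measure, integral_smul_measure] at hcongr
  refine smul_right_injective _ ?_ hcongr
  exact ENNReal.toReal_ne_zero.2 ⟨ENNReal.inv_ne_zero.2 (measure_ne_top _ _), ENNReal.inv_ne_top.2 h0⟩

/-- Coalescence at grid times does not change the expectation of a pattern determinant. -/
theorem integral_patternDet_gridRoot_succ (T : ℝ≥0) {M k : ℕ} (hk : k < M + 1)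
    {n m : ℕ} (b : Fin n → Fin m) (y : Fin m → ℤ) (lab : Fin n → ℕ) :
    ∫ ω, patternDet b y
        (fun i => η (gridRoot (gridPath T M fun c t => η c t ω) (k + 1) (lab i)) T ω) ∂μ =
      ∫ ω, patternDet b y
        (fun i => η (gridRoot (gridPath T M fun c t => η c t ω) k (lab i)) T ω) ∂μ := by
  classical
  obtain ⟨N, hN⟩ : ∃ N, ∀ i, lab i < N :=
    ⟨Finset.univ.sup lab + 1, fun i => Nat.lt_succ_of_le (Finset.le_sup (Finset.mem_univ i))⟩
  -- The countably many possible histories at the grid times `0, …, k + 1`. On each of them both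
  -- root maps are constant, and the two roots of a particle are at the same site at the last of
  -- these times.
  let A : (Fin N → Fin (k + 2) → ℤ) → Set Ω := fun z =>
    {ω | ∀ c : Fin N, ∀ l : Fin (k + 2), η c (gridTime T M l) ω = z c l}
  have hAm : ∀ z, MeasurableSet (A z) := fun z => by
    have : A z = ⋂ c : Fin N, ⋂ l : Fin (k + 2), η c (gridTime T M l) ⁻¹' {z c l} := by
      ext ω
      simp [A]
    rw [this]
    exact MeasurableSet.iInter fun c => MeasurableSet.iInter fun l =>
      (hη c).measurable _ (.singleton (z c l))
  have hAd : Pairwise (Function.onFun Disjoint A) := fun z z' hne =>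
    Set.disjoint_left.2 fun ω h h' => hne (funext fun c => funext fun l =>
      (h c l).symm.trans (h' c l))
  have hAu : ⋃ z, A z = Set.univ :=
    Set.eq_univ_of_forall fun ω => Set.mem_iUnion.2 ⟨fun c l => η c (gridTime T M l) ω,
      fun _ _ => rfl⟩
  have hint : ∀ k, Integrable (fun ω => patternDet b y
      (fun i => η (gridRoot (gridPath T M fun c t => η c t ω) k (lab i)) T ω)) μ := fun k =>
    integrable_patternDet b y (measurable_pi_lambda _ fun i =>
      measurable_gridRoot_position hη T M k (lab i))
  rw [← setIntegral_univ, ← setIntegral_univ (μ := μ), ← hAu,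
    integral_iUnion hAm hAd (hint _).integrableOn, integral_iUnion hAm hAd (hint _).integrableOn]
  refine tsum_congr fun z => ?_
  let d : ℕ → ℕ → ℤ := fun l c => if hlc : l < k + 2 ∧ c < N then z ⟨c, hlc.2⟩ ⟨l, hlc.1⟩ else 0
  have hd : ∀ ω ∈ A z, ∀ l ≤ k + 1, ∀ c < N, gridPath T M (fun c t => η c t ω) l c = d l c := by
    intro ω hω l hl c hc
    simp only [d]
    rw [dif_pos ⟨by omega, hc⟩]
    exact hω ⟨c, hc⟩ ⟨l, by omega⟩
  have hlt : ∀ l i, gridRoot d l (lab i) < N := fun l i => (gridRoot_le d l _).trans_lt (hN i)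
  have hroot : ∀ l ≤ k + 1, ∀ ω ∈ A z, ∀ i,
      gridRoot (gridPath T M fun c t => η c t ω) l (lab i) = gridRoot d l (lab i) :=
    fun l hl ω hω i => gridRoot_congr (fun l' hl' => hd ω hω l' (hl'.trans hl)) (hN i)
  have hconst : ∀ l ≤ k + 1, ∫ ω in A z, patternDet b y
      (fun i => η (gridRoot (gridPath T M fun c t => η c t ω) l (lab i)) T ω) ∂μ =
      ∫ ω in A z, patternDet b y
      (fun i => η ((⟨gridRoot d l (lab i), hlt l i⟩ : Fin N) : ℕ) T ω) ∂μ := fun l hl =>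
    setIntegral_congr_fun (hAm z) fun ω hω => by
      simp only [hroot l hl ω hω]
  rw [hconst (k + 1) le_rfl, hconst k (by omega)]
  refine setIntegral_patternDet_congr hη hindep (τ := fun l : Fin (k + 2) => gridTime T M l)
    (fun l l' h => gridTime_mono T M h) (gridTime_zero T M) (gridTime_le T hk) z b y fun i => ?_
  have h := gridRoot_succ_position d k (lab i)
  simp only [d] at h
  rw [dif_pos ⟨by omega, hlt (k + 1) i⟩, dif_pos ⟨by omega, hlt k i⟩] at h
  exact h

theorem integral_patternDet_gridRoot (T : ℝ≥0) {M k : ℕ} (hk : k ≤ M + 1)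
    {n m : ℕ} (b : Fin n → Fin m) (y : Fin m → ℤ) (lab : Fin n → ℕ) :
    ∫ ω, patternDet b y
        (fun i => η (gridRoot (gridPath T M fun c t => η c t ω) k (lab i)) T ω) ∂μ =
      (coalescenceMatrix (p 0 T) (fun i => x (lab i)) b y).det := by
  induction k with
  | zero =>
    have hW : iIndepFun (fun n ω => η n T ω) μ :=
      hindep.comp (fun _ (f : ℝ≥0 → ℤ) => f T) fun _ => measurable_pi_apply T
    have h := integral_patternDet hW (fun c => (hη c).measurable T) lab b y
    refine h.trans (congrArg _ ?_)
    ext i j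
    -- A one-point set gives a `P` entry, a half-line an `F` entry.
    have hV : ∀ V : Set ℤ, μ.real (η (lab i) T ⁻¹' V) = ∑' v : V, p 0 T (x (lab i)) v := by
      intro V
      have hm := (hη (lab i)).measurable T
      have h1 := Measure.tsum_indicator_apply_singleton (μ.map (η (lab i) T)) V .of_discrete
      rw [← tsum_subtype, Measure.map_apply hm .of_discrete] at h1
      rw [measureReal_def, ← h1, ENNReal.tsum_toReal_eq]
      · refine tsum_congr fun v => ?_
        rw [Measure.map_apply hm (.singleton _)]
        exact (hη (lab i)).real_eq T v
      · intro v
        rw [Measure.map_apply hm (.singleton _)]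
        exact measure_ne_top _ _
    rw [Matrix.sub_apply, Matrix.of_apply]
    change μ.real (η (lab i) T ⁻¹' _) - _ = _
    by_cases hj : ∃ j' < j, b j' = b j
    · simp only [columnSet, staircase, coalescenceMatrix, Matrix.of_apply, hj, true_and, if_true]
      rw [hV, cumulative]
    · simp only [columnSet, staircase, coalescenceMatrix, Matrix.of_apply, hj, false_and, if_false, sub_zero]
      exact (hη (lab i)).real_eq T _
  | succ k ih =>
    rw [integral_patternDet_gridRoot_succ hη hindep T hk]
    exact ih (by omega)

end

/-! ### Passage to continuous time -/

theorem IsMarkovProcessFrom.rightConst {Ω : Type*} [MeasurableSpace Ω] {μ : Measure Ω}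
    {p : ℝ≥0 → ℝ≥0 → ℤ → ℤ → ℝ} {x : ℤ} {ξ : ℝ≥0 → Ω → ℤ} (h : IsMarkovProcessFrom μ p x ξ)
    (ω : Ω) : RightConst fun t => ξ t ω := fun t => by
  have h1 : Tendsto (fun s => ξ s ω) (𝓝[≥] t) (𝓝 (ξ t ω)) := h.right_continuous ω t
  rwa [nhds_discrete, tendsto_pure] at h1

section

variable {Ω : Type*} [MeasurableSpace Ω] {μ : Measure Ω}
  {p : ℝ≥0 → ℝ≥0 → ℤ → ℤ → ℝ} {η : ℕ → ℝ≥0 → Ω → ℤ} {x : ℕ → ℤ}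
  (hη : ∀ n, IsMarkovProcessFrom μ p (x n) (η n)) (hx : Function.Injective x)
include hη hx

theorem eventually_gridRoot_position_eq (T : ℝ≥0) (n : ℕ) (ω : Ω) :
    ∀ᶠ M in atTop, η (gridRoot (gridPath T M fun c t => η c t ω) (M + 1) n) T ω =
      arratia (fun c t => η c t ω) n T := by
  have h0 : Function.Injective fun n => η n 0 ω := fun m n h => hx <| by
    rw [← (hη m).start ω, ← (hη n).start ω]
    exact h
  filter_upwards [eventually_gridRoot_eq_arratia (fun n => (hη n).rightConst ω) h0 T n] with M hM
  have h := hM (M + 1) le_rfl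
  rwa [gridTime_last] at h

theorem measurable_arratia (T : ℝ≥0) (n : ℕ) :
    Measurable fun ω => arratia (fun c t => η c t ω) n T :=
  measurable_of_tendsto_metrizable (fun M => measurable_gridRoot_position hη T M (M + 1) n)
    (tendsto_pi_nhds.2 fun ω =>
      tendsto_nhds_of_eventually_eq (eventually_gridRoot_position_eq hη hx T n ω))

/-- The expectation of a pattern determinant of coalescing particles is the determinant of the
coalescence matrix. -/
theorem integral_patternDet_arratia [IsProbabilityMeasure μ]
    (hindep : iIndepFun (fun n ω t => η n t ω) μ) (T : ℝ≥0)
    {n m : ℕ} (b : Fin n → Fin m) (y : Fin m → ℤ) (lab : Fin n → ℕ) :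
    ∫ ω, patternDet b y (fun i => arratia (fun c t => η c t ω) (lab i) T) ∂μ =
      (coalescenceMatrix (p 0 T) (fun i => x (lab i)) b y).det := by
  have h : Tendsto (fun M : ℕ => ∫ ω, patternDet b y (fun i =>
      η (gridRoot (gridPath T M fun c t => η c t ω) (M + 1) (lab i)) T ω) ∂μ) atTop
      (𝓝 (∫ ω, patternDet b y (fun i => arratia (fun c t => η c t ω) (lab i) T) ∂μ)) := by
    refine tendsto_integral_of_dominated_convergence (fun _ => n.factorial * 2 ^ n) (fun M => ?_)
      (integrable_const _) (fun M => ae_of_all _ fun ω => abs_patternDet_le b y _)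
      (ae_of_all _ fun ω => tendsto_nhds_of_eventually_eq ?_)
    · exact (integrable_patternDet b y (measurable_pi_lambda _ fun i =>
        measurable_gridRoot_position hη T M (M + 1) (lab i))).aestronglyMeasurable
    · filter_upwards [eventually_all.2 fun i =>
        eventually_gridRoot_position_eq hη hx T (lab i) ω] with M hM
      simp only [hM]
  -- The approximating expectations do not depend on the grid, so their limit is their common value.
  simp_rw [integral_patternDet_gridRoot hη hindep T le_rfl] at h
  exact tendsto_nhds_unique h tendsto_const_nhds

end

/-! ### From flanking particles to walls, and the conclusion -/

theorem monotone_flanking {k : ℕ} {a : Fin k → ℤ} (ha : StrictMono a) : Monotone (flanking a) := by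
  intro i j hij
  unfold flanking
  have hij' : (i : ℕ) ≤ j := hij
  rcases (Nat.div_le_div_right (c := 2) hij').lt_or_eq with h | h
  · have : a ⟨(i : ℕ) / 2, by omega⟩ < a ⟨(j : ℕ) / 2, by omega⟩ := ha (by exact h)
    omega
  · simp only [h]
    omega

theorem monotone_zigzagPattern (k : ℕ) : Monotone (zigzagPattern k) := by
  intro i j hij
  have hij' : (i : ℕ) ≤ j := hij
  simp only [zigzagPattern, Fin.mk_le_mk]
  omega

theorem forall_flanking_iff {k : ℕ} (f : ℤ → ℤ) (a : Fin k → ℤ) (y : Fin (k + 1) → ℤ) :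
    (∀ i, f (flanking a i) = y (zigzagPattern k i)) ↔
      ∀ l : Fin k, f (a l) = y l.castSucc ∧ f (a l + 1) = y l.succ := by
  constructor
  · intro h l
    have h1 := h ⟨2 * l, by omega⟩
    have h2 := h ⟨2 * l + 1, by omega⟩
    have e1 : flanking a ⟨2 * l, by omega⟩ = a l := by
      simp [flanking]
    have e2 : flanking a ⟨2 * l + 1, by omega⟩ = a l + 1 := by
      have : (2 * (l : ℕ) + 1) / 2 = l := by omega
      simp [flanking, this, Nat.add_mod]
    have e3 : zigzagPattern k ⟨2 * l, by omega⟩ = l.castSucc := by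
      ext; simp only [zigzagPattern, Fin.val_castSucc]; omega
    have e4 : zigzagPattern k ⟨2 * l + 1, by omega⟩ = l.succ := by
      ext; simp only [zigzagPattern, Fin.val_succ]; omega
    rw [e1, e3] at h1
    rw [e2, e4] at h2
    exact ⟨h1, h2⟩
  · intro h i
    have hl := h ⟨(i : ℕ) / 2, by omega⟩
    rcases Nat.mod_two_eq_zero_or_one i with hi | hi
    · have e : zigzagPattern k i = Fin.castSucc ⟨(i : ℕ) / 2, by omega⟩ := by
        ext; simp only [zigzagPattern, Fin.castSucc_mk]; omega
      rw [e, flanking, hi]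
      simpa using hl.1
    · have e : zigzagPattern k i = Fin.succ ⟨(i : ℕ) / 2, by omega⟩ := by
        ext; simp only [zigzagPattern, Fin.succ_mk]; omega
      rw [e, flanking, hi]
      simpa using hl.2

/-- Only the particles next to the walls matter for a pattern. -/
theorem containsPattern_iff {f : ℤ → ℤ} (hf : Monotone f) {k : ℕ} (a : Fin k → ℤ)
    {y : Fin (k + 1) → ℤ} (hy : StrictMono y) :
    ContainsPattern f a y ↔ ∀ i, f (flanking a i) = y (zigzagPattern k i) := by
  rw [forall_flanking_iff]
  refine forall_congr' fun l => ⟨fun h => ⟨h.1.1, h.2.1⟩, fun h => ?_⟩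
  have hlt : y l.castSucc < y l.succ := hy (Fin.castSucc_lt_succ)
  refine ⟨⟨h.1, fun z hz => ?_⟩, ⟨h.2, fun z hz => ?_⟩⟩
  · have hz : f z = y l.castSucc := hz
    by_contra! hlt'
    have := hf (Int.add_one_le_of_lt hlt')
    omega
  · have hz : f z = y l.succ := hz
    by_contra! hlt'
    have := hf (Int.le_of_lt_add_one hlt')
    omega

theorem measurableSet_containsPattern {Ω : Type*} [MeasurableSpace Ω] {f : ℤ → Ω → ℤ}
    (hf : ∀ x, Measurable (f x)) {k : ℕ} (a : Fin k → ℤ) (y : Fin (k + 1) → ℤ) :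
    MeasurableSet {ω | ContainsPattern (fun x => f x ω) a y} := by
  have hm : ∀ x v, MeasurableSet {ω | f x ω = v} := fun x v => hf x (.singleton v)
  have : {ω | ContainsPattern (fun x => f x ω) a y} = ⋂ l : Fin k,
      ({ω | f (a l) ω = y l.castSucc} ∩ ⋂ z, {ω | f z ω = y l.castSucc → z ≤ a l}) ∩
      ({ω | f (a l + 1) ω = y l.succ} ∩ ⋂ z, {ω | f z ω = y l.succ → a l + 1 ≤ z}) := by
    ext ω
    simp [ContainsPattern, WallRightOf, WallLeftOf, IsGreatest, IsLeast, upperBounds, lowerBounds,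
      basin]
  rw [this]
  exact MeasurableSet.iInter fun l => MeasurableSet.inter
    ((hm _ _).inter (MeasurableSet.iInter fun z => (hm z _).imp (.const _)))
    ((hm _ _).inter (MeasurableSet.iInter fun z => (hm z _).imp (.const _)))

theorem mainTheorem1 {Ω : Type*} [MeasurableSpace Ω] (μ : Measure Ω) [IsProbabilityMeasure μ]
    (p : ℝ≥0 → ℝ≥0 → ℤ → ℤ → ℝ) (hp : IsTransitionFunction p)
    (ξ : ℤ → ℝ≥0 → Ω → ℤ) (hξ : ∀ x, IsMarkovProcessFrom μ p x (ξ x))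
    (hindep : iIndepFun (fun (x : ℤ) (ω : Ω) (t : ℝ≥0) => ξ x t ω) μ)
    (hskip : IsSkipFree μ ξ)
    (rank : ℤ ≃ ℕ) (T : ℝ≥0) (hT : 0 < T)
    (k : ℕ) (hk : 1 ≤ k) (a : Fin k → ℤ) (ha : StrictMono a)
    (y : Fin (k + 1) → ℤ) (hy : StrictMono y) :
    MeasurableSet {ω | ContainsPattern
      (fun x => coalescingSystem rank (fun z t => ξ z t ω) x T) a y} ∧
    μ.real {ω | ContainsPattern
      (fun x => coalescingSystem rank (fun z t => ξ z t ω) x T) a y} =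
      (coalescenceMatrix (p 0 T) (flanking a) (zigzagPattern k) y).det := by
  classical
  have hη : ∀ n, IsMarkovProcessFrom μ p (rank.symm n) (ξ (rank.symm n)) := fun n => hξ _
  have hmeas := measurableSet_containsPattern
    (f := fun x ω => coalescingSystem rank (fun z t => ξ z t ω) x T)
    (fun x => measurable_arratia hη rank.symm.injective T (rank x)) a y
  refine ⟨hmeas, ?_⟩
  have hmono : ∀ᵐ ω ∂μ, Monotone fun x => coalescingSystem rank (fun z t => ξ z t ω) x T := by
    -- There are only countably many pairs of sites, so one null set serves all of them.
    have h : ∀ᵐ ω ∂μ, ∀ x y : ℤ, x < y → ∀ t : ℝ≥0,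
        (∀ u ≤ t, ξ x u ω ≠ ξ y u ω) → ξ x t ω < ξ y t ω := by
      rw [ae_all_iff]; intro x
      rw [ae_all_iff]; intro y
      by_cases hxy : x < y
      · filter_upwards [hskip x y hxy] with ω hω _ using hω
      · exact ae_of_all _ fun ω h => absurd h hxy
    filter_upwards [h] with ω hω
    have hstart : ∀ n, ξ (rank.symm n) 0 ω = rank.symm n := fun n => (hξ _).start ω
    refine monotone_iff_forall_lt.2 fun x y hxy => ?_
    refine arratia_le_arratia (fun n => (hη n).rightConst ω) (fun m n h => ?_)
      (fun m n h => ?_) ?_ T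
    · simpa [hstart] using h
    · rw [hstart, hstart] at h
      exact hω _ _ h
    · rw [hstart, hstart]
      simpa using hxy
  have h := integral_patternDet_arratia hη rank.symm.injective
    (hindep.precomp rank.symm.injective) T (zigzagPattern k) y fun i => rank (flanking a i)
  simp only [Equiv.symm_apply_apply] at h
  rw [← h, ← integral_indicator_one hmeas]
  -- Wherever order is preserved, the determinant equals the indicator of the event.
  refine integral_congr_ae ?_
  filter_upwards [hmono] with ω hω
  rw [Set.indicator_apply]
  refine Eq.trans ?_ (det_indicator_sub_staircase (monotone_zigzagPattern k) hy
    (x := fun i => coalescingSystem rank (fun z t => ξ z t ω) (flanking a i) T)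
    (hω.comp (monotone_flanking ha))).symm
  exact if_congr (containsPattern_iff hω a hy) rfl rfl
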